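/- For $M\ge 1$ index the coordinates of $\mathbb{C}^M$ by $\mathbb{Z}_M$, and let $\pi(k,\ell)$, for $(k,\ell)\in\mathbb{Z}_M\times\mathbb{Z}_M$, be the time-frequency shift $(\pi(k,\ell)x)(m)=e^{2\pi i\ell m/M}x(m-k)$. For a window $g\in\mathbb{C}^M$ and $Q,P\subset\mathbb{Z}_M$, define the auxiliary windows $$g_{qpt}(m)=g(m)\left(1+e^{2\pi i(mp/M+t/3)}\,\frac{g(m-q)}{g(m)}\right),\qquad q\in Q,\ p\in P,\ t\in\{0,1,2\},$$ and let $G=\{g\}\cup\{g_{qpt}: q\in Q,\,p\in P,\,t\in\{0,1,2\}\}$. For $\Lambda\subset\mathbb{Z}_M\times\mathbb{Z}_M$ let $(G,\Lambda)=\{\pi(\lambda)h : \lambda\in\Lambda,\ h\in G\}$ be the corresponding multi-window Gabor system. A finite family $\{\varphi_j\}_j$ in $\mathbb{C}^M$ is called a phase retrievable frame if it spans $\mathbb{C}^M$ and, for all $x,y\in\mathbb{C}^M$, the equalities $|\langle x,\varphi_j\rangle|^2=|\langle y,\varphi_j\rangle|^2$ for all $j$ imply $y=e^{i\theta}x$ for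 some $\theta\in\mathbb{R}$. Let $C>3$ be an integer. There is a constant $\alpha_0=\alpha_0(C)>0$ such that for every $\alpha\ge\alpha_0$ there is a constant $K=K(C,\alpha)$ with the following property. For $M \ge 1$ and $T\subset\mathbb{Z}_M$ with $|T|=C$, put $\Lambda=T\times\mathbb{Z}_M$ and $Q=T-T$. Let $g$ be uniformly distributed on the unit sphere of $\mathbb{C}^M$, and let $P$ be a random subset of $\mathbb{Z}_M$ such that the indicators $\mathbf{1}_P(m)$, $m\in\mathbb{Z}_M$, are i.i.d. Bernoulli$\left(\frac{\alpha\log M}{M}\right)$; no assumption is made on the joint law of $g$ and $P$. Then, with high probability, $(G,\Lambda)$ is a phase retrievable frame and its number of vectors (counted with multiplicity) is at most $K\,M\log M$. Here "with high probability" means that the probability of failure tends to $0$ as $M\to\infty$, uniformly in $T$: for every $\varepsilon>0$ there is $M_0=M_0(C,\alpha,\varepsilon)$ such that, for all $M\ge M_0$, all $T$ with $|T|=C$ and all such $g$ and $P$, the probability of failure is at most $\varepsilon$. -/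

import Mathlib

open scoped Pointwise

noncomputable section

namespace GaborPR

/-- The signal space `ℂ^M`, with coordinates indexed by `ℤ/M` and the Euclidean norm. -/
abbrev Signal (M : ℕ) : Type := EuclideanSpace ℂ (ZMod M)

section Operators

variable {M : ℕ} [NeZero M]

/-- Translation `(T_k x)(m) = x(m - k)`. -/
def translation (k : ZMod M) (x : Signal M) : Signal M :=
  WithLp.toLp 2 fun m => x (m - k)

/-- Modulation `(M_ℓ x)(m) = e^{2πi ℓ m / M} x(m)`; here
`ZMod.stdAddChar j = e^{2πi j / M}` for `j` in `ℤ/M`. -/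
def modulation (l : ZMod M) (x : Signal M) : Signal M :=
  WithLp.toLp 2 fun m => ZMod.stdAddChar (l * m) * x m

/-- The time-frequency shift `π(k, ℓ) = M_ℓ T_k`. -/
def tfShift (kl : ZMod M × ZMod M) (x : Signal M) : Signal M :=
  modulation kl.2 (translation kl.1 x)

/-- The multi-window Gabor system `(G, Λ) = {π(λ) g_r}`, for windows `g_r` indexed by `ι`. -/
def multiWindowGabor {ι : Type*} (G : ι → Signal M) (Λ : Finset (ZMod M × ZMod M)) :
    ι × Λ → Signal M :=
  fun j => tfShift (j.2 : ZMod M × ZMod M) (G j.1)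

/-- The mask `s_{qpt}(m) = 1 + e^{2πi (m p / M + t / 3)} g(m - q) / g(m)`. -/
def mask (g : Signal M) (q p : ZMod M) (t : Fin 3) : Signal M :=
  WithLp.toLp 2 fun m =>
    1 + ZMod.stdAddChar (m * p) * Complex.exp (2 * Real.pi * Complex.I * ((t : ℕ) : ℂ) / 3) *
      (g (m - q) / g m)

/-- The auxiliary window `g_{qpt} = g ⊙ s_{qpt}` (coordinatewise product). -/
def auxWindow (g : Signal M) (q p : ZMod M) (t : Fin 3) : Signal M :=
  WithLp.toLp 2 fun m => g m * mask g q p t m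

/-- The windows `{g} ∪ {g_{qpt} : q ∈ Q, p ∈ P, t ∈ {0, 1, 2}}`; the index `none` is the
primary window `g`. -/
def windows (g : Signal M) (Q P : Finset (ZMod M)) : Option (Q × P × Fin 3) → Signal M
  | none => g
  | some (q, p, t) => auxWindow g q p t

end Operators

section PhaseRetrieval

variable {M : ℕ} {J : Type*}

/-- The phaseless measurement map `x ↦ (|⟨x, φ_j⟩|²)_j`. -/
def phaselessMap [NeZero M] (Φ : J → Signal M) (x : Signal M) : J → ℝ :=
  fun j => ‖inner ℂ (Φ j) x‖ ^ 2

/-- `Φ` is a phase retrievable frame: it spans `ℂ^M`, and the phaseless measurements determine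
every signal up to a global phase. -/
def IsPhaseRetrievable [NeZero M] (Φ : J → Signal M) : Prop :=
  Submodule.span ℂ (Set.range Φ) = ⊤ ∧
    ∀ x y : Signal M, phaselessMap Φ x = phaselessMap Φ y →
      ∃ θ : ℝ, y = Complex.exp (θ * Complex.I) • x

end PhaseRetrieval

/-- The uniform distribution on the unit sphere of `ℂ^M`: the surface measure induced by Lebesgue
measure, normalized to total mass one. -/
def uniformSphere (M : ℕ) [NeZero M] :
    MeasureTheory.Measure (Metric.sphere (0 : Signal M) 1) :=
  ((MeasureTheory.volume : MeasureTheory.Measure (Signal M)).toSphere Set.univ)⁻¹ •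
    (MeasureTheory.volume : MeasureTheory.Measure (Signal M)).toSphere

/-- `P` is a random subset of `ℤ/M` whose membership indicators are i.i.d. Bernoulli(`p`):
the events `m ∈ P` are mutually independent, each of probability `p`. -/
structure IsBernoulliSubset {M : ℕ} {Ω : Type*} [MeasurableSpace Ω]
    (P : Ω → Finset (ZMod M)) (p : ℝ) (μ : MeasureTheory.Measure Ω) : Prop where
  measurableSet_mem : ∀ m : ZMod M, MeasurableSet {ω | m ∈ P ω}
  indep : ProbabilityTheory.iIndepSet (fun m : ZMod M => {ω | m ∈ P ω}) μ
  prob_mem : ∀ m : ZMod M, μ.real {ω | m ∈ P ω} = p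

/-- The multi-window Gabor system with primary window `g`, time-frequency set `Λ = T × ℤ/M`,
and auxiliary windows indexed by `Q = T - T` and `P`. -/
def corollaryFrame {M : ℕ} [NeZero M] (g : Signal M) (T P : Finset (ZMod M)) :
    Option (↥(T - T) × P × Fin 3) × ↥(T ×ˢ (Finset.univ : Finset (ZMod M))) → Signal M :=
  multiWindowGabor (windows g (T - T) P) (T ×ˢ Finset.univ)

/-- The number of phaseless measurements, that is, of vectors in `corollaryFrame g T P`
(counted with multiplicity). -/
def numMeasurements {M : ℕ} [NeZero M] (T P : Finset (ZMod M)) : ℕ :=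
  Fintype.card
    (Option (↥(T - T) × P × Fin 3) × ↥(T ×ˢ (Finset.univ : Finset (ZMod M))))

end GaborPR

end

noncomputable section

namespace GaborPR

/-! The shift `π(a) g_{qpt}` equals `π(a) g` plus a unimodular multiple of `π(a + (q, p)) g`. Three
cube roots of unity therefore polarize: the measurements determine `⟨x, π(a) g⟩` times the conjugate
of `⟨x, π(b) g⟩` for all `a, b ∈ Λ` whose second coordinates differ by an element of `P`. Hence, if
`x` and `y` have equal measurements, the ratio of their coefficients is constant along the edges of
a Cayley-type graph on the support of the coefficients of `x`.

Two facts finish the argument.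

Full spark: almost surely any `M` distinct shifts of `g` span. So fewer than `M` coefficients of a
nonzero `x` vanish, and a ratio constant on `M` points is constant everywhere. One window with
nonzero determinant suffices for each choice of shifts (`exists_det_gaborMatrix_ne_zero`); it is
found among `g(m) = t^{w(m)}` by isolating one coefficient in `t`, a block Vandermonde determinant.

Expansion: Chernoff bounds make all nontrivial character sums of `P` small, and the expander mixing
lemma then gives a level set of the ratio missing at most `M` points of the support
(`exists_large_level_set`). With `|T| ≥ 3` that leaves at least `M` points. -/

/-! ### One coefficient of a determinant of monomials -/

/-- The residue of `i - k` modulo `M` in `[0, M)`, for `i, k` in `[0, M)`. -/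
def cyclicOffset (M i k : ℕ) : ℕ := if k ≤ i then i - k else i + M - k

/-- A strictly convex weight on `[0, M)` whose linear part dominates the quadratic part. -/
def convexWeight (M n : ℕ) : ℕ := (M ^ 3 + 1) * n + n ^ 2

/-- Equality in the rearrangement inequality makes `κ ∘ σ⁻¹` monotone, and a tuple has only one
monotone rearrangement. -/
lemma comp_perm_eq_of_sum_mul_eq {M : ℕ} {κ : Fin M → ℕ} (hmono : Monotone κ)
    (σ : Equiv.Perm (Fin M))
    (h : ∑ j : Fin M, (σ j : ℕ) * κ j = ∑ j : Fin M, (j : ℕ) * κ j) (j : Fin M) :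
    κ (σ j) = κ j := by
  have hmv : Monovary (fun j : Fin M => (j : ℕ)) κ := by
    intro a b hab
    by_contra hc
    push Not at hc
    exact absurd (hmono (le_of_lt (show b < a from hc))) (not_le.2 hab)
  have h1 : Monovary ((fun j : Fin M => (j : ℕ)) ∘ σ) κ :=
    (Monovary.sum_comp_perm_mul_eq_sum_mul_iff hmv).1 h
  have h2 : Monotone (κ ∘ σ.symm) := by
    intro a b hab
    by_contra hc
    push Not at hc
    have h3 := h1 hc
    simp only [Function.comp_apply, Equiv.apply_symm_apply] at h3
    have h4 : a = b := le_antisymm hab h3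
    subst h4
    exact lt_irrefl _ hc
  have h3 := Tuple.unique_monotone (f := κ) (σ := σ.symm) (τ := 1) h2 (by simpa using hmono)
  have h4 := congrFun h3 (σ j)
  simpa using h4.symm

/-- The identity never wraps around, because `κ j ≤ j`. The linear part of the weight forbids
wrapping for any `σ` of the same weight; the quadratic part then reduces to the equality case of
rearrangement. -/
lemma sum_convexWeight_eq_iff {M : ℕ} {κ : Fin M → ℕ} (hmono : Monotone κ)
    (hκ : ∀ j : Fin M, κ j ≤ j) (σ : Equiv.Perm (Fin M)) :
    ∑ j, convexWeight M (cyclicOffset M (σ j) (κ j)) =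
      ∑ j : Fin M, convexWeight M (cyclicOffset M j (κ j)) ↔ ∀ j, κ (σ j) = κ j := by
  constructor
  · intro h
    set e : Fin M → ℤ := fun j => if κ j ≤ σ j then 0 else 1 with he
    have hoff : ∀ j, ((cyclicOffset M (σ j) (κ j) : ℕ) : ℤ) = (σ j : ℤ) - κ j + M * e j := by
      intro j
      have := hκ j
      have := j.isLt
      simp only [cyclicOffset, he]
      split_ifs <;> omega
    have hoff0 : ∀ j : Fin M, ((cyclicOffset M j (κ j) : ℕ) : ℤ) = (j : ℤ) - κ j := by
      intro j
      have := hκ j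
      simp only [cyclicOffset, if_pos this]
      omega
    have hσ1 : ∑ j, ((σ j : ℕ) : ℤ) = ∑ j : Fin M, ((j : ℕ) : ℤ) :=
      Equiv.sum_comp σ (fun j : Fin M => ((j : ℕ) : ℤ))
    have hσ2 : ∑ j, ((σ j : ℕ) : ℤ) ^ 2 = ∑ j : Fin M, ((j : ℕ) : ℤ) ^ 2 :=
      Equiv.sum_comp σ (fun j : Fin M => ((j : ℕ) : ℤ) ^ 2)
    have hZ : ∑ j, (((M : ℤ) ^ 3 + 1) * ((σ j : ℤ) - κ j + M * e j)
          + ((σ j : ℤ) - κ j + M * e j) ^ 2) =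
        ∑ j : Fin M, (((M : ℤ) ^ 3 + 1) * ((j : ℤ) - κ j) + ((j : ℤ) - κ j) ^ 2) := by
      have := congrArg (Nat.cast : ℕ → ℤ) h
      simp only [convexWeight] at this
      push_cast at this
      simpa only [hoff, hoff0] using this
    simp only [Finset.sum_add_distrib, ← Finset.mul_sum, Finset.sum_sub_distrib, hσ1] at hZ
    have hsq : ∑ j : Fin M, ((j : ℤ) - κ j) ^ 2 ≤ (M : ℤ) ^ 3 := by
      calc ∑ j : Fin M, ((j : ℤ) - κ j) ^ 2 ≤ ∑ j : Fin M, (M : ℤ) ^ 2 := by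
            apply Finset.sum_le_sum
            intro j _
            have := hκ j
            have := j.isLt
            apply pow_le_pow_left₀ <;> omega
        _ = (M : ℤ) ^ 3 := by simp; ring
    have hsq0 : 0 ≤ ∑ j, ((σ j : ℤ) - κ j + M * e j) ^ 2 :=
      Finset.sum_nonneg fun _ _ => sq_nonneg _
    have hM : 1 ≤ M ∨ M = 0 := by omega
    rcases hM with hM | hM
    swap
    · subst hM; intro j; exact j.elim0
    have hM' : (1 : ℤ) ≤ M := by exact_mod_cast hM
    have he0 : ∀ j, 0 ≤ e j := fun j => by simp only [he]; split_ifs <;> norm_num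
    -- `e` counts wraps. A single wrap costs `(M ^ 3 + 1) * M`, more than the whole quadratic part
    -- of the identity, which is at most `M ^ 3`.
    have hesum : ∑ j, e j = 0 := by
      by_contra hne
      have h1 : 1 ≤ ∑ j, e j := by
        have : 0 ≤ ∑ j, e j := Finset.sum_nonneg fun j _ => he0 j
        omega
      have h2 : (1 : ℤ) ≤ M * ∑ j, e j := by nlinarith
      have h3 : (0 : ℤ) < (M : ℤ) ^ 3 + 1 := by positivity
      nlinarith
    have hej : ∀ j, e j = 0 := fun j =>
      (Finset.sum_eq_zero_iff_of_nonneg (fun j _ => he0 j)).1 hesum j (Finset.mem_univ j)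
    simp only [hej, mul_zero, add_zero, Finset.sum_const_zero] at hZ
    have hZ2 := add_left_cancel hZ
    simp only [sub_sq, Finset.sum_add_distrib, Finset.sum_sub_distrib, hσ2] at hZ2
    -- The pure squares agree on both sides, so only the cross terms survive.
    have hZ3 : ∑ j, 2 * (σ j : ℤ) * κ j = ∑ j : Fin M, 2 * (j : ℤ) * κ j := by linarith
    simp only [mul_assoc, ← Finset.mul_sum] at hZ3
    apply comp_perm_eq_of_sum_mul_eq hmono σ
    have : ∑ j, (σ j : ℤ) * κ j = ∑ j : Fin M, (j : ℤ) * κ j := by linarith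
    exact_mod_cast this
  · intro h
    rw [← Equiv.sum_comp σ (fun j : Fin M => convexWeight M (cyclicOffset M j (κ j)))]
    simp only [h]

open Polynomial in
/-- The coefficient of `X ^ W` in the determinant of a matrix of monomials, when the permutations
of total degree `W` are exactly those supported on a mask. -/
lemma coeff_det_monomial {n R : Type*} [Fintype n] [DecidableEq n] [CommRing R]
    (N : Matrix n n R) (d : n → n → ℕ) (E : n → n → Prop) [DecidableRel E] (W : ℕ)
    (h : ∀ σ : Equiv.Perm n, ∑ j, d (σ j) j = W ↔ ∀ j, E (σ j) j) :
    (Matrix.det (Matrix.of fun i j => C (N i j) * X ^ d i j)).coeff W =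
      Matrix.det (Matrix.of fun i j => if E i j then N i j else 0) := by
  rw [Matrix.det_apply, Matrix.det_apply, Polynomial.finsetSum_coeff]
  refine Finset.sum_congr rfl fun σ _ => ?_
  simp only [Matrix.of_apply]
  rw [Polynomial.coeff_smul, Finset.prod_mul_distrib, ← map_prod, Finset.prod_pow_eq_pow_sum,
    Polynomial.coeff_C_mul, Polynomial.coeff_X_pow]
  congr 1
  by_cases hE : ∀ j, E (σ j) j
  · rw [if_pos ((h σ).2 hE).symm, mul_one]
    exact Finset.prod_congr rfl fun j _ => (if_pos (hE j)).symm
  · rw [if_neg fun hW => hE ((h σ).1 hW.symm), mul_zero]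
    push Not at hE
    obtain ⟨j, hj⟩ := hE
    exact (Finset.prod_eq_zero (Finset.mem_univ j) (if_neg hj)).symm

open Polynomial in
/-- A block diagonal matrix whose blocks are Vandermonde matrices with distinct nodes is
invertible; the blocks are the level sets of a monotone function. -/
lemma det_block_vandermonde_ne_zero {M : ℕ} {F : Type*} [Field F] {κ : Fin M → ℕ}
    (hmono : Monotone κ) (z c : Fin M → F) (hc : ∀ j, c j ≠ 0)
    (hz0 : ∀ j, z j ≠ 0)
    (hz : ∀ i j, κ i = κ j → z i = z j → i = j) :
    Matrix.det (Matrix.of fun i j : Fin M => if κ i = κ j then c j * z j ^ (i : ℕ) else 0) ≠ 0 := by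
  classical
  intro hdet
  obtain ⟨v, hv0, hv⟩ := Matrix.exists_vecMul_eq_zero_iff.2 hdet
  apply hv0
  funext i₀
  set B : Finset (Fin M) := Finset.univ.filter fun i => κ i = κ i₀ with hB
  have hi₀ : i₀ ∈ B := by simp [hB]
  set a : Fin M := B.min' ⟨i₀, hi₀⟩ with ha
  have haB : a ∈ B := Finset.min'_mem _ _
  have hale : ∀ i ∈ B, a ≤ i := fun i hi => Finset.min'_le _ _ hi
  have hdeg : ∀ i ∈ B, (i : ℕ) - a < B.card := by
    intro i hi
    have h1 : Finset.Icc a i ⊆ B := by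
      intro m hm
      rw [Finset.mem_Icc] at hm
      have h2 := hmono hm.1
      have h3 := hmono hm.2
      simp only [hB, Finset.mem_filter, Finset.mem_univ, true_and] at haB hi ⊢
      omega
    have h2 := Finset.card_le_card h1
    rw [Fin.card_Icc] at h2
    have h3 : (a : ℕ) ≤ i := hale i hi
    omega
  -- The block `B` is an interval starting at `a`, so this polynomial has degree less than `B.card`,
  -- yet a left kernel vector `v` makes it vanish at the `B.card` distinct nodes of the block.
  set p : F[X] := ∑ i ∈ B, C (v i) * X ^ ((i : ℕ) - a) with hp
  have hcoeff : p.coeff ((i₀ : ℕ) - a) = v i₀ := by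
    rw [hp, Polynomial.finsetSum_coeff, Finset.sum_eq_single i₀]
    · simp
    · intro b hb hne
      rw [Polynomial.coeff_C_mul, Polynomial.coeff_X_pow, if_neg, mul_zero]
      intro h
      apply hne
      have h1 : (a : ℕ) ≤ b := hale b hb
      have h2 : (a : ℕ) ≤ i₀ := hale i₀ hi₀
      exact Fin.ext (by omega)
    · exact fun h => absurd hi₀ h
  have hzero : p = 0 := by
    have hinj : Set.InjOn z B := by
      intro i hi j hj hij
      simp only [hB, Finset.coe_filter, Finset.mem_univ, true_and, Set.mem_ofPred_eq] at hi hj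
      exact hz i j (hi.trans hj.symm) hij
    have hcard : (B.image z).card = B.card := Finset.card_image_of_injOn hinj
    apply Polynomial.eq_zero_of_natDegree_lt_card_of_eval_eq_zero' p (B.image z)
    · intro x hx
      obtain ⟨j, hj, rfl⟩ := Finset.mem_image.1 hx
      have hj' : κ j = κ i₀ := by simpa [hB] using hj
      have h1 : (c j * z j ^ (a : ℕ)) * Polynomial.eval (z j) p = 0 := by
        refine Eq.trans ?_ (congrFun hv j)
        simp only [hp, Polynomial.eval_finsetSum, Polynomial.eval_mul, Polynomial.eval_C,
          Polynomial.eval_pow, Polynomial.eval_X, Matrix.vecMul, dotProduct, Matrix.of_apply,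
          mul_ite, mul_zero, hj']
        rw [← Finset.sum_filter, Finset.mul_sum]
        refine Finset.sum_congr rfl fun i hi => ?_
        have h2 : (a : ℕ) ≤ i := hale i hi
        have h3 : z j ^ (i : ℕ) = z j ^ (a : ℕ) * z j ^ ((i : ℕ) - a) := by
          rw [← pow_add, Nat.add_sub_cancel' h2]
        rw [h3]
        ring
      exact (mul_eq_zero.1 h1).resolve_left (mul_ne_zero (hc j) (pow_ne_zero _ (hz0 j)))
    · rw [hcard]
      have hpos : 0 < B.card := Finset.card_pos.2 ⟨i₀, hi₀⟩
      refine lt_of_le_of_lt (Polynomial.natDegree_sum_le_of_forall_le (n := B.card - 1) B _ ?_)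
        (by omega)
      intro i hi
      have := hdeg i hi
      exact (Polynomial.natDegree_C_mul_X_pow_le _ _).trans (by omega)
  rw [hzero] at hcoeff
  simpa using hcoeff.symm

/-! ### Cyclic ordering of the shifts -/

/-- Cyclic ballot lemma: if `M` points lie over `ℤ/M`, from a suitable origin every initial
segment of length `i + 1` has at least `i + 1` points over it. -/
lemma exists_ballot_origin {M : ℕ} [NeZero M] {ι : Type*} [Fintype ι]
    (hcard : Fintype.card ι = M) (f : ι → ZMod M) :
    ∃ o : ZMod M, ∀ i < M, i + 1 ≤ (Finset.univ.filter fun a => (f a - o).val ≤ i).card := by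
  classical
  set s : ZMod M → ℕ := fun k => (Finset.univ.filter fun a => f a = k).card with hs
  -- The excess of points over sites is `M`-periodic, since there are `M` of each; an origin where
  -- it is minimal works.
  set H : ℕ → ℤ := fun n => ∑ k ∈ Finset.range n, (s (k : ZMod M) : ℤ) - n with hH
  have hM : 0 < M := Nat.pos_of_ne_zero (NeZero.ne M)
  have hsum : ∑ k ∈ Finset.range M, s (k : ZMod M) = M := by
    have h1 : ∑ k : ZMod M, s k = M := by
      have h2 : (Finset.univ : Finset ι).card = M := by rw [Finset.card_univ, hcard]
      rw [← Finset.card_eq_sum_card_fiberwise (f := f) (fun _ _ => Finset.mem_univ _), h2]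
    refine Eq.trans ?_ h1
    refine Finset.sum_nbij' (fun k : ℕ => (k : ZMod M)) ZMod.val ?_ ?_ ?_ ?_ ?_
    · simp
    · intro a _; simpa using ZMod.val_lt a
    · intro a ha; exact ZMod.val_natCast_of_lt (by simpa using ha)
    · intro a _; exact ZMod.natCast_zmod_val a
    · simp
  have hper : ∀ n, H (n + M) = H n := by
    intro n
    simp only [hH]
    rw [add_comm n M, Finset.sum_range_add]
    have : (∑ k ∈ Finset.range M, (s (k : ZMod M) : ℤ)) = M := by exact_mod_cast hsum
    rw [this]
    push_cast
    simp
  obtain ⟨n₀, -, hn₀⟩ := Finset.exists_min_image (Finset.range M) H ⟨0, by simpa using hM⟩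
  have hmin : ∀ n, H n₀ ≤ H n := by
    intro n
    induction n using Nat.strong_induction_on with
    | _ n ih =>
      by_cases hn : n < M
      · exact hn₀ n (by simpa using hn)
      · have := hper (n - M)
        rw [Nat.sub_add_cancel (by omega)] at this
        rw [this]
        exact ih _ (by omega)
  refine ⟨(n₀ : ZMod M), fun i hi => ?_⟩
  have h1 := hmin (n₀ + (i + 1))
  simp only [hH] at h1
  rw [Finset.sum_range_add _ n₀ (i + 1)] at h1
  push_cast at h1
  have h2 : (i + 1 : ℤ) ≤ ∑ k ∈ Finset.range (i + 1), (s ((n₀ : ZMod M) + (k : ZMod M)) : ℤ) := by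
    linarith
  have h3 : ∑ k ∈ Finset.range (i + 1), s ((n₀ : ZMod M) + (k : ZMod M)) ≤
      (Finset.univ.filter fun a => (f a - (n₀ : ZMod M)).val ≤ i).card := by
    rw [Finset.card_eq_sum_card_fiberwise (f := fun a => (f a - (n₀ : ZMod M)).val)
      (t := Finset.range (i + 1))]
    · refine Finset.sum_le_sum fun k hk => Finset.card_le_card fun a ha => ?_
      have hk' : k < i + 1 := by simpa using hk
      simp only [Finset.mem_filter, Finset.mem_univ, true_and] at ha ⊢
      have : (f a - (n₀ : ZMod M)).val = k := by
        rw [ha, add_sub_cancel_left, ZMod.val_natCast_of_lt (by omega)]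
      exact ⟨by omega, this⟩
    · intro a ha
      simp only [Finset.coe_filter, Finset.mem_univ, true_and, Set.mem_ofPred_eq] at ha
      simp only [Finset.coe_range, Set.mem_Iio]
      omega
  have h4 : ((∑ k ∈ Finset.range (i + 1), s ((n₀ : ZMod M) + (k : ZMod M)) : ℕ) : ℤ) ≥ i + 1 := by
    push_cast; exact h2
  omega

/-- Points over `ℤ/M` can be listed in cyclic order from a suitable origin so that the `j`-th point
sits at distance at most `j` from the origin. -/
lemma exists_sorted_enumeration {M : ℕ} [NeZero M] (S : Finset (ZMod M × ZMod M))
    (hS : S.card = M) :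
    ∃ (o : ZMod M) (e : Fin M ≃ S),
      Monotone (fun j => ((e j : ZMod M × ZMod M).1 - o).val) ∧
      ∀ j : Fin M, ((e j : ZMod M × ZMod M).1 - o).val ≤ j := by
  obtain ⟨o, ho⟩ := exists_ballot_origin (ι := S) (by simpa using hS) fun a => (a : ZMod M × ZMod M).1
  set e₀ : Fin M ≃ S := (Fintype.equivFinOfCardEq (by simpa using hS)).symm
  set f : Fin M → ℕ := fun j => ((e₀ j : ZMod M × ZMod M).1 - o).val with hf
  refine ⟨o, (Tuple.sort f).trans e₀, Tuple.monotone_sort f, fun i => ?_⟩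
  set e := (Tuple.sort f).trans e₀
  have hmono : Monotone (fun j => ((e j : ZMod M × ZMod M).1 - o).val) := Tuple.monotone_sort f
  by_contra hlt
  push Not at hlt
  have h1 := ho i i.isLt
  -- If the `i`-th point were farther than `i`, all points within distance `i`, at least `i + 1` of
  -- them, would have one of the `i` earlier indices.
  have h2 : (Finset.univ.filter fun a : S => ((a : ZMod M × ZMod M).1 - o).val ≤ i) ⊆
      (Finset.Iio i).map e.toEmbedding := by
    intro a ha
    simp only [Finset.mem_filter, Finset.mem_univ, true_and] at ha
    rw [Finset.mem_map_equiv, Finset.mem_Iio]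
    by_contra hc
    push Not at hc
    have h3 := hmono hc
    simp only [Equiv.apply_symm_apply] at h3
    omega
  have h3 := Finset.card_le_card h2
  rw [Finset.card_map, Fin.card_Iio] at h3
  omega

/-! ### Full spark of almost every window -/

lemma stdAddChar_ne_zero {M : ℕ} [NeZero M] (k : ZMod M) : ZMod.stdAddChar k ≠ (0 : ℂ) :=
  norm_ne_zero_iff.1 (by rw [AddChar.norm_apply]; exact one_ne_zero)

/-- The matrix whose columns are the time-frequency shifts `π(e j) g`, its rows being numbered
cyclically from the origin `o`. -/
def gaborMatrix {M : ℕ} [NeZero M] (o : ZMod M) (e : Fin M → ZMod M × ZMod M) (g : Signal M) :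
    Matrix (Fin M) (Fin M) ℂ :=
  Matrix.of fun i j => tfShift (e j) g (((i : ℕ) : ZMod M) + o)

lemma tfShift_apply {M : ℕ} [NeZero M] (kl : ZMod M × ZMod M) (x : Signal M) (m : ZMod M) :
    tfShift kl x m = ZMod.stdAddChar (kl.2 * m) * x (m - kl.1) := rfl

lemma val_natCast_sub {M : ℕ} [NeZero M] {i : ℕ} (hi : i < M) (k : ZMod M) :
    ((i : ZMod M) - k).val = cyclicOffset M i k.val := by
  have hk := ZMod.val_lt k
  have h : ((cyclicOffset M i k.val : ℕ) : ZMod M) = (i : ZMod M) - k := by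
    unfold cyclicOffset
    split_ifs with h
    · rw [Nat.cast_sub h, ZMod.natCast_zmod_val]
    · rw [Nat.cast_sub (by omega)]; simp
  rw [← h, ZMod.val_natCast_of_lt]
  unfold cyclicOffset
  split_ifs <;> omega

open Polynomial in
/-- Any `M` distinct time-frequency shifts of a suitable window are linearly independent. -/
lemma exists_det_gaborMatrix_ne_zero {M : ℕ} [NeZero M] {o : ZMod M}
    {e : Fin M → ZMod M × ZMod M} (he : Function.Injective e)
    (hmono : Monotone (fun j => ((e j).1 - o).val)) (hle : ∀ j : Fin M, ((e j).1 - o).val ≤ j) :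
    ∃ g : Signal M, (gaborMatrix o e g).det ≠ 0 := by
  set κ : Fin M → ℕ := fun j => ((e j).1 - o).val with hκ
  set N : Matrix (Fin M) (Fin M) ℂ := Matrix.of fun i j =>
    ZMod.stdAddChar ((e j).2 * (((i : ℕ) : ZMod M) + o)) with hN
  set D : ℂ[X] := Matrix.det (Matrix.of fun i j : Fin M =>
    C (N i j) * X ^ convexWeight M (cyclicOffset M i (κ j))) with hD
  have hD0 : D ≠ 0 := by
    intro h0
    have h1 := coeff_det_monomial N (fun i j : Fin M => convexWeight M (cyclicOffset M i (κ j)))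
      (fun i j => κ i = κ j) _ (sum_convexWeight_eq_iff hmono hle)
    rw [← hD, h0, Polynomial.coeff_zero] at h1
    refine det_block_vandermonde_ne_zero hmono (fun j => ZMod.stdAddChar (e j).2)
      (fun j => ZMod.stdAddChar ((e j).2 * o)) ?_ ?_ ?_ ?_
    · intro j; exact stdAddChar_ne_zero _
    · intro j; exact stdAddChar_ne_zero _
    -- Within a block the translations coincide, so distinct shifts have distinct modulations: the
    -- Vandermonde nodes differ.
    · intro i j hij hz
      apply he
      have h2 := ZMod.val_injective M hij
      exact Prod.ext (sub_left_injective h2) (ZMod.injective_stdAddChar hz)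
    · refine Eq.trans ?_ h1.symm
      congr 1
      ext i j
      simp only [Matrix.of_apply, hN]
      refine if_congr Iff.rfl ?_ rfl
      rw [mul_add, AddChar.map_add_eq_mul, mul_comm (e j).2 (i : ZMod M), ← nsmul_eq_mul,
        AddChar.map_nsmul_eq_pow, mul_comm]
  obtain ⟨t, ht⟩ : ∃ t, D.eval t ≠ 0 := by
    by_contra h
    push Not at h
    exact hD0 (Polynomial.funext (by simpa using h))
  refine ⟨WithLp.toLp 2 fun m => t ^ convexWeight M m.val, ?_⟩
  convert ht
  rw [hD, ← Polynomial.coe_evalRingHom, RingHom.map_det]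
  congr 1
  ext i j
  simp only [gaborMatrix, tfShift_apply, Matrix.of_apply, RingHom.mapMatrix_apply, Matrix.map_apply,
    hN, Polynomial.coe_evalRingHom, Polynomial.eval_mul, Polynomial.eval_pow, Polynomial.eval_C,
    Polynomial.eval_X]
  rw [hκ, ← val_natCast_sub i.isLt]
  congr 3
  ring_nf

/-- Windows for which any `M` distinct time-frequency shifts span the signal space. -/
def FullSpark {M : ℕ} [NeZero M] (g : Signal M) : Prop :=
  ∀ S : Finset (ZMod M × ZMod M), S.card = M → ∀ x : Signal M,
    (∀ a ∈ S, inner ℂ (tfShift a g) x = 0) → x = 0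

lemma gaborMatrix_line {M : ℕ} [NeZero M] (o : ZMod M) (e : Fin M → ZMod M × ZMod M)
    (y g : Signal M) (z : ℂ) :
    gaborMatrix o e (y + z • g) = z • gaborMatrix o e g + gaborMatrix o e y := by
  ext i j
  simp [gaborMatrix, tfShift_apply]
  ring

lemma continuous_det_gaborMatrix {M : ℕ} [NeZero M] (o : ZMod M)
    (e : Fin M → ZMod M × ZMod M) : Continuous fun g : Signal M => (gaborMatrix o e g).det := by
  apply Continuous.matrix_det
  refine continuous_matrix fun i j => ?_
  simp only [gaborMatrix, tfShift_apply, Matrix.of_apply]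
  fun_prop

-- On each complex line in the direction `g₀` the determinant is a polynomial in the parameter whose
-- coefficient of degree `M` is the nonzero determinant at `g₀`. The zero set thus meets every such
-- line in a finite set.
open MeasureTheory Polynomial in
lemma ae_det_gaborMatrix_ne_zero {M : ℕ} [NeZero M] {o : ZMod M}
    {e : Fin M → ZMod M × ZMod M} (h : ∃ g : Signal M, (gaborMatrix o e g).det ≠ 0) :
    ∀ᵐ g : Signal M, (gaborMatrix o e g).det ≠ 0 := by
  obtain ⟨g₀, hg₀⟩ := h
  have hopen : IsOpen {g : Signal M | (gaborMatrix o e g).det ≠ 0} :=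
    isOpen_ne_fun (continuous_det_gaborMatrix o e) continuous_const
  refine ae_mem_of_ae_add_linearMap_mem ((LinearMap.id : ℂ →ₗ[ℂ] ℂ).smulRight g₀)
    (volume : Measure ℂ) (volume : Measure (Signal M)) hopen.measurableSet fun y => ?_
  set p : ℂ[X] := Matrix.det ((X : ℂ[X]) • (gaborMatrix o e g₀).map (C : ℂ →+* ℂ[X]) +
    (gaborMatrix o e y).map (C : ℂ →+* ℂ[X])) with hp
  have hp0 : p ≠ 0 := by
    intro h0
    have h1 := Polynomial.coeff_det_X_add_C_card (gaborMatrix o e g₀) (gaborMatrix o e y)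
    rw [← hp, h0, Polynomial.coeff_zero] at h1
    exact hg₀ h1.symm
  have heval : ∀ z, (gaborMatrix o e (y + z • g₀)).det = p.eval z := by
    intro z
    rw [gaborMatrix_line, hp, ← Polynomial.coe_evalRingHom, RingHom.map_det]
    congr 1
    ext i j
    simp
    exact mul_comm _ _
  have hfin : (p.rootSet ℂ).Finite := Polynomial.rootSet_finite p ℂ
  have hnull : ∀ᵐ z : ℂ, z ∉ p.rootSet ℂ :=
    measure_eq_zero_iff_ae_notMem.1 (hfin.measure_zero _)
  filter_upwards [hnull] with z hz
  change (gaborMatrix o e (y + z • g₀)).det ≠ 0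
  rw [heval]
  intro h0
  apply hz
  rw [Polynomial.mem_rootSet]
  exact ⟨hp0, by simpa using h0⟩

-- The determinant is homogeneous, so the cone over its zeros on the sphere lies in its null zero
-- set in the full space.
open MeasureTheory in
lemma ae_toSphere_det_gaborMatrix_ne_zero {M : ℕ} [NeZero M] {o : ZMod M}
    {e : Fin M → ZMod M × ZMod M} (h : ∃ g : Signal M, (gaborMatrix o e g).det ≠ 0) :
    ∀ᵐ g : Metric.sphere (0 : Signal M) 1 ∂((volume : Measure (Signal M)).toSphere), (gaborMatrix o e (g : Signal M)).det ≠ 0 := by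
  have hclosed : IsClosed {g : Metric.sphere (0 : Signal M) 1 |
      (gaborMatrix o e (g : Signal M)).det = 0} :=
    isClosed_eq ((continuous_det_gaborMatrix o e).comp continuous_subtype_val) continuous_const
  rw [ae_iff]
  simp only [not_not]
  rw [Measure.toSphere_apply' _ hclosed.measurableSet]
  refine mul_eq_zero_of_right _ (measure_mono_null ?_ (ae_iff.1 (ae_det_gaborMatrix_ne_zero h)))
  rintro _ ⟨r, -, _, ⟨g, hg, rfl⟩, rfl⟩
  have h1 := gaborMatrix_line o e 0 (g : Signal M) (r : ℂ)
  have h0 : gaborMatrix o e (0 : Signal M) = 0 := by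
    ext i j
    simp [gaborMatrix, tfShift_apply]
  have h2 : r • (g : Signal M) = (0 : Signal M) + (r : ℂ) • (g : Signal M) := by
    rw [zero_add, Complex.coe_smul]
  have h3 : (gaborMatrix o e (g : Signal M)).det = 0 := hg
  simp only [Set.mem_ofPred_eq, not_not, h2]
  rw [h1, h0, add_zero, Matrix.det_smul, h3, mul_zero]

/-- Orthogonality to all columns puts the conjugate of `x` in the left kernel of the matrix. -/
lemma eq_zero_of_det_gaborMatrix_ne_zero {M : ℕ} [NeZero M] {o : ZMod M}
    {e : Fin M → ZMod M × ZMod M} {g x : Signal M} (hg : (gaborMatrix o e g).det ≠ 0)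
    (hx : ∀ j, inner ℂ (tfShift (e j) g) x = 0) : x = 0 := by
  have h2 : Matrix.vecMul (fun i : Fin M => (starRingEnd ℂ) (x (((i : ℕ) : ZMod M) + o)))
      (gaborMatrix o e g) = 0 := by
    funext j
    have h3 := congrArg (starRingEnd ℂ) (hx j)
    rw [map_zero, inner_conj_symm, PiLp.inner_apply] at h3
    refine Eq.trans ?_ h3
    simp only [Matrix.vecMul, dotProduct, gaborMatrix, Matrix.of_apply]
    refine Finset.sum_bij (fun i _ => ((i : ℕ) : ZMod M) + o) ?_ ?_ ?_ ?_
    · simp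
    · intro a _ b _ hab
      have h4 := congrArg ZMod.val (add_right_cancel hab)
      rw [ZMod.val_natCast_of_lt a.isLt, ZMod.val_natCast_of_lt b.isLt] at h4
      exact Fin.ext h4
    · intro m _
      exact ⟨⟨(m - o).val, ZMod.val_lt _⟩, Finset.mem_univ _, by simp⟩
    · intro a _
      simp [mul_comm]
  have h3 := Matrix.eq_zero_of_vecMul_eq_zero hg h2
  ext m
  have h4 := congrFun h3 ⟨(m - o).val, ZMod.val_lt _⟩
  simpa using h4

open MeasureTheory in
/-- Almost every window generates a Gabor frame of full spark. -/
lemma ae_fullSpark_uniformSphere (M : ℕ) [NeZero M] :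
    ∀ᵐ g : Metric.sphere (0 : Signal M) 1 ∂(uniformSphere M), FullSpark (g : Signal M) := by
  refine Measure.ae_smul_measure ?_ _
  refine ae_all_iff.2 fun S => ?_
  by_cases hS : S.card = M
  swap
  · exact Filter.Eventually.of_forall fun g h => absurd h hS
  obtain ⟨o, e, hmono, hle⟩ := exists_sorted_enumeration S hS
  have h1 := ae_toSphere_det_gaborMatrix_ne_zero (exists_det_gaborMatrix_ne_zero
    (e := fun j => (e j : ZMod M × ZMod M)) (Subtype.val_injective.comp e.injective) hmono hle)
  filter_upwards [h1] with g hg _ x hx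
  exact eq_zero_of_det_gaborMatrix_ne_zero hg fun j => hx _ (e j).2

open MeasureTheory ProbabilityTheory

/-! ### Chernoff bounds for the character sums of a random set -/

section Concentration

variable {M : ℕ} [NeZero M] {Ω : Type*} [MeasurableSpace Ω] {μ : Measure Ω}
  [IsProbabilityMeasure μ] {P : Ω → Finset (ZMod M)} {p : ℝ}

open Classical in
/-- The centred membership indicator of `m`, weighted by `c`. -/
def centredIndicator (P : Ω → Finset (ZMod M)) (p c : ℝ) (m : ZMod M) (ω : Ω) : ℝ :=
  ((if m ∈ P ω then 1 else 0) - p) * c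

omit [NeZero M] [MeasurableSpace Ω] in
lemma centredIndicator_eq_comp (P : Ω → Finset (ZMod M)) (p c : ℝ) (m : ZMod M) :
    centredIndicator P p c m =
      (fun x : ℝ => (x - p) * c) ∘ ({ω | m ∈ P ω}.indicator fun _ => (1 : ℝ)) := by
  classical
  funext ω
  simp only [centredIndicator, Function.comp_apply, Set.indicator_apply, Set.mem_ofPred_eq]

omit [NeZero M] [IsProbabilityMeasure μ] in
lemma measurable_centredIndicator (h : IsBernoulliSubset P p μ) (c : ℝ) (m : ZMod M) :
    Measurable (centredIndicator P p c m) := by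
  rw [centredIndicator_eq_comp]
  have := h.measurableSet_mem m
  exact (by fun_prop : Measurable fun x : ℝ => (x - p) * c).comp
    (measurable_const.indicator this)

-- Use `exp x ≤ 1 + x + x ^ 2` for `|x| ≤ 1`: the linear terms average to zero and the variance `p *
-- (1 - p)` is at most `p`.
omit [NeZero M] in
lemma mgf_centredIndicator_le (h : IsBernoulliSubset P p μ) {c s : ℝ} (hc : |c| ≤ 1)
    (hs0 : 0 ≤ s) (hs1 : s ≤ 1) (m : ZMod M) :
    mgf (centredIndicator P p c m) μ s ≤ Real.exp (s ^ 2 * p) := by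
  classical
  have hp0 : 0 ≤ p := by rw [← h.prob_mem m]; exact measureReal_nonneg
  have hp1 : p ≤ 1 := by rw [← h.prob_mem m]; exact measureReal_le_one
  have hA := h.measurableSet_mem m
  set A : Set Ω := {ω | m ∈ P ω} with hAdef
  set u : ℝ := Real.exp (s * ((1 - p) * c)) with hu
  set v : ℝ := Real.exp (s * ((0 - p) * c)) with hv
  have hfun : (fun ω => Real.exp (s * centredIndicator P p c m ω)) =
      fun ω => A.indicator (fun _ => u - v) ω + v := by
    funext ω
    simp only [centredIndicator, Set.indicator_apply, hAdef, Set.mem_ofPred_eq]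
    split_ifs <;> simp [hu, hv]
  have hval : mgf (centredIndicator P p c m) μ s = p * u + (1 - p) * v := by
    rw [mgf, hfun, integral_add ((integrable_const _).indicator hA) (integrable_const _),
      integral_indicator_const _ hA, h.prob_mem m]
    simp
    ring
  have hb : ∀ q : ℝ, |q| ≤ 1 → Real.exp (s * (q * c)) ≤ 1 + s * (q * c) + s ^ 2 * q ^ 2 := by
    intro q hq
    have h1 : |q * c| ≤ 1 := by
      rw [abs_mul]; exact mul_le_one₀ hq (abs_nonneg _) hc
    have h2 : |s * (q * c)| ≤ 1 := by
      rw [abs_mul, abs_of_nonneg hs0]; exact mul_le_one₀ hs1 (abs_nonneg _) h1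
    have h3 := (abs_le.1 (Real.abs_exp_sub_one_sub_id_le h2)).2
    have h4 : (s * (q * c)) ^ 2 ≤ s ^ 2 * q ^ 2 := by
      have h5 : c ^ 2 ≤ 1 := (sq_le_one_iff_abs_le_one c).2 hc
      have : (s * (q * c)) ^ 2 = s ^ 2 * q ^ 2 * c ^ 2 := by ring
      rw [this]
      exact mul_le_of_le_one_right (by positivity) h5
    linarith
  have hu' := hb (1 - p) (by rw [abs_le]; constructor <;> linarith)
  have hv' := hb (0 - p) (by rw [abs_le]; constructor <;> linarith)
  rw [hval]
  have h6 : p * u + (1 - p) * v ≤ s ^ 2 * p + 1 := by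
    have e1 := mul_le_mul_of_nonneg_left hu' hp0
    have e2 := mul_le_mul_of_nonneg_left hv' (sub_nonneg.2 hp1)
    have e3 : 0 ≤ s ^ 2 * p ^ 2 := by positivity
    nlinarith
  exact h6.trans (Real.add_one_le_exp _)

/-- Chernoff's bound for weighted sums of centred membership indicators. -/
lemma measureReal_sum_centredIndicator_ge_le (h : IsBernoulliSubset P p μ) {c : ZMod M → ℝ}
    (hc : ∀ m, |c m| ≤ 1) {δ : ℝ} (hδ0 : 0 ≤ δ) (hδ1 : δ ≤ 2) :
    μ.real {ω | δ * (M * p) ≤ ∑ m, centredIndicator P p (c m) m ω} ≤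
      Real.exp (-(δ ^ 2 * (M * p) / 4)) := by
  have hind : iIndepFun (fun m => centredIndicator P p (c m) m) μ := by
    simp only [centredIndicator_eq_comp]
    exact h.indep.iIndepFun_indicator.comp (fun m (x : ℝ) => (x - p) * c m)
      fun m => by fun_prop
  have hmeas := fun m => measurable_centredIndicator h (c m) m
  -- The parameter `s = δ / 2` minimizes `s ^ 2 - s * δ`; the bound `δ ≤ 2` keeps it at most `1`.
  have hmgf : mgf (∑ m, centredIndicator P p (c m) m) μ (δ / 2) ≤
      Real.exp ((δ / 2) ^ 2 * (M * p)) := by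
    rw [hind.mgf_sum hmeas]
    calc _ ≤ ∏ _m : ZMod M, Real.exp ((δ / 2) ^ 2 * p) :=
          Finset.prod_le_prod (fun _ _ => mgf_nonneg) fun m _ =>
            mgf_centredIndicator_le h (hc m) (by linarith) (by linarith) m
      _ = _ := by
          rw [Finset.prod_const, ← Real.exp_nat_mul, Finset.card_univ, ZMod.card]
          congr 1
          ring
  have hint : Integrable (fun ω => Real.exp (δ / 2 * (∑ m, centredIndicator P p (c m) m) ω)) μ := by
    have hp0 : 0 ≤ p := by rw [← h.prob_mem 0]; exact measureReal_nonneg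
    have hp1 : p ≤ 1 := by rw [← h.prob_mem 0]; exact measureReal_le_one
    refine Integrable.of_bound (C := Real.exp (δ / 2 * M)) ?_ ?_
    · simp only [Finset.sum_apply]
      exact ((Finset.measurable_sum _ fun m _ => hmeas m).const_mul _).exp.aestronglyMeasurable
    · refine Filter.Eventually.of_forall fun ω => ?_
      rw [Real.norm_eq_abs, abs_of_pos (Real.exp_pos _), Real.exp_le_exp]
      refine mul_le_mul_of_nonneg_left ?_ (by linarith)
      rw [Finset.sum_apply]
      calc _ ≤ ∑ _m : ZMod M, (1 : ℝ) := by
            refine Finset.sum_le_sum fun m _ => (le_abs_self _).trans ?_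
            rw [centredIndicator, abs_mul]
            refine mul_le_one₀ ?_ (abs_nonneg _) (hc m)
            rw [abs_le]
            split_ifs <;> constructor <;> linarith
        _ = M := by simp
  have h1 := measure_ge_le_exp_mul_mgf (δ * (M * p)) (by linarith : 0 ≤ δ / 2) hint
  simp only [Finset.sum_apply] at h1
  refine h1.trans ((mul_le_mul_of_nonneg_left hmgf (Real.exp_nonneg _)).trans ?_)
  rw [← Real.exp_add, Real.exp_le_exp]
  nlinarith

/-- The deviation from its mean of the character sum of `P` at frequency `j`. -/
def charSumDeviation (P : Finset (ZMod M)) (p : ℝ) (j : ZMod M) : ℂ :=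
  ∑ a ∈ P, ZMod.stdAddChar (j * a) - p * ∑ m : ZMod M, ZMod.stdAddChar (j * m)

omit [MeasurableSpace Ω] in
lemma charSumDeviation_re (P : Ω → Finset (ZMod M)) (p : ℝ) (j : ZMod M) (ω : Ω) :
    (charSumDeviation (P ω) p j).re =
      ∑ m, centredIndicator P p (ZMod.stdAddChar (j * m) : ℂ).re m ω := by
  classical
  simp only [charSumDeviation, centredIndicator, sub_mul, Finset.sum_sub_distrib, ite_mul, one_mul,
    zero_mul, Finset.sum_ite_mem, Finset.univ_inter, ← Finset.mul_sum]
  simp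

omit [MeasurableSpace Ω] in
lemma charSumDeviation_im (P : Ω → Finset (ZMod M)) (p : ℝ) (j : ZMod M) (ω : Ω) :
    (charSumDeviation (P ω) p j).im =
      ∑ m, centredIndicator P p (ZMod.stdAddChar (j * m) : ℂ).im m ω := by
  classical
  simp only [charSumDeviation, centredIndicator, sub_mul, Finset.sum_sub_distrib, ite_mul, one_mul,
    zero_mul, Finset.sum_ite_mem, Finset.univ_inter, ← Finset.mul_sum]
  simp

lemma measureReal_abs_sum_centredIndicator_gt_le (h : IsBernoulliSubset P p μ) {c : ZMod M → ℝ}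
    (hc : ∀ m, |c m| ≤ 1) {δ : ℝ} (hδ0 : 0 ≤ δ) (hδ1 : δ ≤ 2) :
    μ.real {ω | δ * (M * p) < |∑ m, centredIndicator P p (c m) m ω|} ≤
      2 * Real.exp (-(δ ^ 2 * (M * p) / 4)) := by
  have h1 := measureReal_sum_centredIndicator_ge_le h hc hδ0 hδ1
  have h2 := measureReal_sum_centredIndicator_ge_le h (c := fun m => -c m)
    (fun m => by rw [abs_neg]; exact hc m) hδ0 hδ1
  have h3 : {ω | δ * (M * p) < |∑ m, centredIndicator P p (c m) m ω|} ⊆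
      {ω | δ * (M * p) ≤ ∑ m, centredIndicator P p (c m) m ω} ∪
      {ω | δ * (M * p) ≤ ∑ m, centredIndicator P p (-c m) m ω} := by
    intro ω hω
    have h4 : ∑ m, centredIndicator P p (-c m) m ω = -∑ m, centredIndicator P p (c m) m ω := by
      simp only [centredIndicator, mul_neg, Finset.sum_neg_distrib]
    rw [Set.mem_ofPred_eq] at hω
    rcases lt_abs.1 hω with h5 | h5
    · exact Or.inl h5.le
    · exact Or.inr (by rw [Set.mem_ofPred_eq, h4]; exact h5.le)
  calc _ ≤ _ := measureReal_mono h3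
    _ ≤ _ := measureReal_union_le _ _
    _ ≤ _ := by linarith

/-- All character sums of a random subset are close to their means. -/
lemma measureReal_exists_charSumDeviation_gt_le (h : IsBernoulliSubset P p μ) {δ : ℝ}
    (hδ0 : 0 ≤ δ) (hδ1 : δ ≤ 2) :
    μ.real {ω | ∃ j, 2 * δ * (M * p) < ‖charSumDeviation (P ω) p j‖} ≤
      M * (4 * Real.exp (-(δ ^ 2 * (M * p) / 4))) := by
  -- The factor `2` in the threshold is shared between the real and the imaginary part.
  have hsub : {ω | ∃ j, 2 * δ * (M * p) < ‖charSumDeviation (P ω) p j‖} ⊆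
      ⋃ j : ZMod M,
        ({ω | δ * (M * p) < |∑ m, centredIndicator P p (ZMod.stdAddChar (j * m) : ℂ).re m ω|} ∪
        {ω | δ * (M * p) < |∑ m, centredIndicator P p (ZMod.stdAddChar (j * m) : ℂ).im m ω|}) := by
    rintro ω ⟨j, hj⟩
    refine Set.mem_iUnion.2 ⟨j, ?_⟩
    by_contra hc
    simp only [Set.mem_union, Set.mem_ofPred_eq, not_or, not_lt, ← charSumDeviation_re,
      ← charSumDeviation_im] at hc
    have := Complex.norm_le_abs_re_add_abs_im (charSumDeviation (P ω) p j)
    linarith [hc.1, hc.2]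
  have hre : ∀ z : ℂ, ‖z‖ = 1 → |z.re| ≤ 1 := fun z hz => hz ▸ Complex.abs_re_le_norm z
  have him : ∀ z : ℂ, ‖z‖ = 1 → |z.im| ≤ 1 := fun z hz => hz ▸ Complex.abs_im_le_norm z
  calc _ ≤ _ := measureReal_mono hsub
    _ ≤ ∑ j : ZMod M, _ := measureReal_iUnion_fintype_le _
    _ ≤ ∑ _j : ZMod M, 4 * Real.exp (-(δ ^ 2 * (M * p) / 4)) := by
        refine Finset.sum_le_sum fun j _ => (measureReal_union_le _ _).trans ?_
        have h1 := measureReal_abs_sum_centredIndicator_gt_le h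
          (c := fun m => (ZMod.stdAddChar (j * m) : ℂ).re)
          (fun m => hre _ (AddChar.norm_apply _ _)) hδ0 hδ1
        have h2 := measureReal_abs_sum_centredIndicator_gt_le h
          (c := fun m => (ZMod.stdAddChar (j * m) : ℂ).im)
          (fun m => him _ (AddChar.norm_apply _ _)) hδ0 hδ1
        linarith
    _ = _ := by simp

end Concentration

/-! ### Fourier analysis and expander mixing -/

section Mixing

variable {M : ℕ} [NeZero M]

lemma sum_stdAddChar_mul (b : ZMod M) :
    ∑ j : ZMod M, (ZMod.stdAddChar (j * b) : ℂ) = if b = 0 then (M : ℂ) else 0 := by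
  have h := AddChar.sum_mulShift (R' := ℂ) b (ZMod.isPrimitive_stdAddChar M)
  rw [h, ZMod.card]
  split_ifs <;> simp

/-- The discrete Fourier transform of a real function, with a positive exponent. -/
def fourierSum (F : ZMod M → ℝ) (j : ZMod M) : ℂ := ∑ l, (F l : ℂ) * ZMod.stdAddChar (j * l)

/-- The number of edges of the Cayley graph of `P`, weighted by `F` at both ends. -/
def edgeSum (P : Finset (ZMod M)) (F : ZMod M → ℝ) : ℝ := ∑ l, ∑ a ∈ P, F l * F (l + a)

/-- After expanding the square, orthogonality of characters keeps only the terms with `l' = l + a`.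
-/
lemma card_mul_edgeSum (P : Finset (ZMod M)) (F : ZMod M → ℝ) :
    ((M * edgeSum P F : ℝ) : ℂ) =
      ∑ j, (‖fourierSum F j‖ ^ 2 : ℝ) * ∑ a ∈ P, (ZMod.stdAddChar (j * a) : ℂ) := by
  have h1 : ∀ j : ZMod M, (‖fourierSum F j‖ ^ 2 : ℝ) * ∑ a ∈ P, (ZMod.stdAddChar (j * a) : ℂ) =
      ∑ l, ∑ l', ∑ a ∈ P, (F l : ℂ) * F l' * ZMod.stdAddChar (j * (l - l' + a)) := by
    intro j
    have h2 : ((‖fourierSum F j‖ ^ 2 : ℝ) : ℂ) =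
        fourierSum F j * (starRingEnd ℂ) (fourierSum F j) := by
      rw [Complex.mul_conj, Complex.normSq_eq_norm_sq]
    rw [h2, fourierSum, map_sum, Finset.sum_mul_sum, Finset.sum_mul]
    refine Finset.sum_congr rfl fun l _ => ?_
    rw [Finset.sum_mul]
    refine Finset.sum_congr rfl fun l' _ => ?_
    rw [Finset.mul_sum]
    refine Finset.sum_congr rfl fun a _ => ?_
    rw [map_mul (starRingEnd ℂ), Complex.conj_ofReal, ← AddChar.map_neg_eq_conj, mul_add, mul_sub, sub_eq_add_neg,
      AddChar.map_add_eq_mul, AddChar.map_add_eq_mul]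
    ring
  rw [Finset.sum_congr rfl fun j _ => h1 j, Finset.sum_comm]
  rw [edgeSum]
  push_cast
  rw [Finset.mul_sum]
  refine Finset.sum_congr rfl fun l _ => ?_
  rw [Finset.sum_comm]
  have h3 : ∀ l' : ZMod M, ∑ j : ZMod M, ∑ a ∈ P,
      (F l : ℂ) * F l' * ZMod.stdAddChar (j * (l - l' + a)) =
      ∑ a ∈ P, if l' = l + a then (M : ℂ) * (F l * F l') else 0 := by
    intro l'
    rw [Finset.sum_comm]
    refine Finset.sum_congr rfl fun a _ => ?_
    rw [← Finset.mul_sum, sum_stdAddChar_mul]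
    have : l - l' + a = 0 ↔ l' = l + a := by
      rw [sub_add_eq_add_sub, sub_eq_zero, eq_comm]
    simp only [this]
    split_ifs <;> ring
  rw [Finset.sum_congr rfl fun l' _ => h3 l', Finset.sum_comm, Finset.mul_sum]
  refine Finset.sum_congr rfl fun a _ => ?_
  simp

/-- Parseval's identity is the edge count of the graph of loops, `P = {0}`. -/
lemma sum_norm_fourierSum_sq (F : ZMod M → ℝ) :
    ∑ j, ‖fourierSum F j‖ ^ 2 = M * ∑ l, F l ^ 2 := by
  have h := card_mul_edgeSum {0} F
  simp only [Finset.sum_singleton, mul_zero, AddChar.map_zero_eq_one, mul_one] at h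
  rw [← Complex.ofReal_sum, Complex.ofReal_inj] at h
  rw [← h, edgeSum]
  simp [sq]

/-- The expander mixing lemma for Cayley graphs of `ℤ/M`. -/
lemma abs_edgeSum_sub_le {P : Finset (ZMod M)} {D : ℝ} (hD : 0 ≤ D)
    (hP : ∀ j : ZMod M, j ≠ 0 → ‖∑ a ∈ P, (ZMod.stdAddChar (j * a) : ℂ)‖ ≤ D) (F : ZMod M → ℝ) :
    |M * edgeSum P F - P.card * (∑ l, F l) ^ 2| ≤ D * (M * ∑ l, F l ^ 2) := by
  classical
  have h := card_mul_edgeSum P F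
  -- The trivial frequency gives the main term; all others are bounded by `D` and Parseval.
  rw [← Finset.add_sum_erase _ _ (Finset.mem_univ (0 : ZMod M))] at h
  have h0 : ((‖fourierSum F 0‖ ^ 2 : ℝ) : ℂ) * ∑ a ∈ P, (ZMod.stdAddChar (0 * a) : ℂ) =
      ((P.card * (∑ l, F l) ^ 2 : ℝ) : ℂ) := by
    have h1 : fourierSum F 0 = ((∑ l, F l : ℝ) : ℂ) := by simp [fourierSum]
    rw [h1, Complex.norm_real, Real.norm_eq_abs, sq_abs]
    simp [mul_comm]
  rw [h0, ← sub_eq_iff_eq_add', ← Complex.ofReal_sub] at h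
  rw [← Real.norm_eq_abs, ← Complex.norm_real, h, ← sum_norm_fourierSum_sq, Finset.mul_sum,
    ← Finset.add_sum_erase _ _ (Finset.mem_univ (0 : ZMod M))]
  refine (norm_sum_le _ _).trans ((Finset.sum_le_sum fun j hj => ?_).trans
    (le_add_of_nonneg_left (by positivity)))
  rw [norm_mul, Complex.norm_real, Real.norm_eq_abs, abs_of_nonneg (sq_nonneg _), mul_comm]
  exact mul_le_mul_of_nonneg_right (hP j (Finset.ne_of_mem_erase hj)) (sq_nonneg _)

end Mixing

/-! ### Large level sets of functions constant along edges -/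

section LevelSets

variable {M : ℕ} [NeZero M]

/-- The number of points of `A` over each element of the second factor. -/
def fiberCount (A : Finset (ZMod M × ZMod M)) (l : ZMod M) : ℝ := (A.filter fun a => a.2 = l).card

lemma sum_fiberCount (A : Finset (ZMod M × ZMod M)) : ∑ l, fiberCount A l = A.card := by
  simp only [fiberCount]
  rw [← Nat.cast_sum, ← Finset.card_eq_sum_card_fiberwise (fun _ _ => Finset.mem_univ _)]

/-- Each fibre injects into `T` by its first coordinate. -/
lemma sum_fiberCount_sq_le {A : Finset (ZMod M × ZMod M)} {T : Finset (ZMod M)}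
    (hA : ∀ a ∈ A, a.1 ∈ T) : ∑ l, fiberCount A l ^ 2 ≤ T.card * A.card := by
  rw [← sum_fiberCount A, Finset.mul_sum]
  refine Finset.sum_le_sum fun l _ => ?_
  rw [sq]
  refine mul_le_mul_of_nonneg_right ?_ (Nat.cast_nonneg _)
  refine Nat.cast_le.2 (Finset.card_le_card_of_injOn Prod.fst ?_ ?_)
  · intro a ha
    exact hA a (Finset.mem_filter.1 ha).1
  · intro a ha b hb hab
    exact Prod.ext hab ((Finset.mem_filter.1 ha).2.trans (Finset.mem_filter.1 hb).2.symm)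

/-- Adjacency depends on second coordinates only, so `fiberCount` counts the edges within `S`; none
of them joins two different level sets. -/
lemma edgeSum_fiberCount_eq_sum {β : Type*} [DecidableEq β] {P : Finset (ZMod M)}
    {S : Finset (ZMod M × ZMod M)} {u : ZMod M × ZMod M → β}
    (hu : ∀ a ∈ S, ∀ b ∈ S, b.2 - a.2 ∈ P → u a = u b) :
    edgeSum P (fiberCount S) =
      ∑ c ∈ S.image u, edgeSum P (fiberCount (S.filter fun a => u a = c)) := by
  simp only [edgeSum]
  rw [Finset.sum_comm (s := S.image u)]
  refine Finset.sum_congr rfl fun l _ => ?_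
  rw [Finset.sum_comm (s := S.image u)]
  refine Finset.sum_congr rfl fun p hp => ?_
  simp only [fiberCount, ← Nat.cast_mul, ← Finset.card_product, ← Nat.cast_sum]
  congr 1
  rw [Finset.card_eq_sum_card_fiberwise (f := fun ab => u ab.1) (t := S.image u)]
  · refine Finset.sum_congr rfl fun c _ => congrArg Finset.card ?_
    ext ⟨a, b⟩
    simp only [Finset.mem_filter, Finset.mem_product]
    constructor
    · rintro ⟨⟨⟨ha, hal⟩, hb, hbl⟩, hc⟩
      have := hu a ha b hb (by rw [hal, hbl]; simpa using hp)
      exact ⟨⟨⟨ha, hc⟩, hal⟩, ⟨hb, this ▸ hc⟩, hbl⟩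
    · rintro ⟨⟨⟨ha, hc⟩, hal⟩, ⟨hb, -⟩, hbl⟩
      exact ⟨⟨⟨ha, hal⟩, hb, hbl⟩, hc⟩
  · rintro ⟨a, b⟩ hab
    simp only [Finset.coe_product, Set.mem_prod, Finset.mem_coe, Finset.mem_filter] at hab
    exact Finset.mem_coe.2 (Finset.mem_image_of_mem u hab.1.1)

/-- A function constant along the edges between points of `S` has a large level set in `S`. -/
lemma exists_large_level_set {β : Type*} [DecidableEq β] {T P : Finset (ZMod M)} {D : ℝ}
    (hP : ∀ j : ZMod M, j ≠ 0 → ‖∑ a ∈ P, (ZMod.stdAddChar (j * a) : ℂ)‖ ≤ D)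
    (hPpos : 0 < P.card) (hD : 2 * D * T.card ≤ P.card) (hD0 : 0 ≤ D)
    {S : Finset (ZMod M × ZMod M)} (hS : S.Nonempty) (hST : ∀ a ∈ S, a.1 ∈ T)
    {u : ZMod M × ZMod M → β} (hu : ∀ a ∈ S, ∀ b ∈ S, b.2 - a.2 ∈ P → u a = u b) :
    ∃ c, S.card ≤ (S.filter fun a => u a = c).card + M := by
  obtain ⟨c₀, -, hmax⟩ := Finset.exists_max_image (S.image u)
    (fun c => (S.filter fun a => u a = c).card) (hS.image u)
  refine ⟨c₀, ?_⟩
  set A : β → Finset (ZMod M × ZMod M) := fun c => S.filter fun a => u a = c with hA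
  have hsum : ∑ c ∈ S.image u, ((A c).card : ℝ) = S.card := by
    rw [← Nat.cast_sum, ← Finset.card_eq_sum_card_image]
  have hsq : ∑ c ∈ S.image u, ((A c).card : ℝ) ^ 2 ≤ (A c₀).card * S.card := by
    rw [← hsum, Finset.mul_sum]
    refine Finset.sum_le_sum fun c hc => ?_
    rw [sq]
    exact mul_le_mul_of_nonneg_right (Nat.cast_le.2 (hmax c hc)) (Nat.cast_nonneg _)
  have hM : (0 : ℝ) < M := Nat.cast_pos.2 (Nat.pos_of_ne_zero (NeZero.ne M))
  have hlow := (abs_le.1 (abs_edgeSum_sub_le hD0 hP (fiberCount S))).1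
  rw [edgeSum_fiberCount_eq_sum hu, sum_fiberCount] at hlow
  have hup : ∀ c, M * edgeSum P (fiberCount (A c)) ≤
      P.card * ((A c).card : ℝ) ^ 2 + D * M * T.card * (A c).card := by
    intro c
    have h1 := (abs_le.1 (abs_edgeSum_sub_le hD0 hP (fiberCount (A c)))).2
    have h2 := sum_fiberCount_sq_le (A := A c) (T := T)
      fun a ha => hST a (Finset.mem_filter.1 ha).1
    rw [sum_fiberCount] at h1
    have h3 := mul_le_mul_of_nonneg_left h2 (mul_nonneg hD0 hM.le)
    linarith
  have hup2 := Finset.sum_le_sum fun c (_ : c ∈ S.image u) => hup c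
  rw [← Finset.mul_sum, Finset.sum_add_distrib, ← Finset.mul_sum, ← Finset.mul_sum, hsum] at hup2
  have hlow2 := mul_le_mul_of_nonneg_left (sum_fiberCount_sq_le hST) (mul_nonneg hD0 hM.le)
  have hPpos' : (0 : ℝ) < P.card := Nat.cast_pos.2 hPpos
  have hSpos : (0 : ℝ) < S.card := Nat.cast_pos.2 (Finset.card_pos.2 hS)
  have h4 := mul_le_mul_of_nonneg_left hsq hPpos'.le
  have h5 := mul_le_mul_of_nonneg_right hD (mul_nonneg hM.le hSpos.le)
  -- Mixing from below on `S` and from above on its level sets leaves two errors `D * M * |T| *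
  -- |S|`; by `hD` their sum is at most `|P| * M * |S|`.
  have h6 : (P.card : ℝ) * S.card * S.card ≤ P.card * S.card * ((A c₀).card + M) := by
    nlinarith
  have h7 := le_of_mul_le_mul_left h6 (mul_pos hPpos' hSpos)
  exact_mod_cast h7

end LevelSets

/-! ### From Gabor measurements to phase retrieval -/

section Gabor

variable {M : ℕ} [NeZero M]

/-- The cube root of unity `e^{2πi t / 3}`. -/
def cubeRoot (t : Fin 3) : ℂ := Complex.exp (2 * Real.pi * Complex.I * ((t : ℕ) : ℂ) / 3)

/-- This turns a measurement with an auxiliary window into the interference of two coefficients with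
respect to `g`. Nonvanishing of `g` is what cancels the quotient in the mask. -/
lemma tfShift_auxWindow {g : Signal M} (hg : ∀ m, g m ≠ 0) (a : ZMod M × ZMod M) (q p : ZMod M)
    (t : Fin 3) :
    tfShift a (auxWindow g q p t) =
      tfShift a g + (ZMod.stdAddChar (-(p * a.1)) * cubeRoot t) • tfShift (a + (q, p)) g := by
  ext m
  have h1 : ZMod.stdAddChar (a.2 * m) * ZMod.stdAddChar ((m - a.1) * p) =
      (ZMod.stdAddChar (-(p * a.1)) * ZMod.stdAddChar ((a.2 + p) * m) : ℂ) := by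
    rw [← AddChar.map_add_eq_mul, ← AddChar.map_add_eq_mul]
    congr 1
    ring
  have h2 := hg (m - a.1)
  simp only [tfShift_apply, auxWindow, mask, PiLp.add_apply, PiLp.smul_apply, Prod.fst_add,
    Prod.snd_add, smul_eq_mul, cubeRoot]
  rw [mul_add, mul_one, mul_add, ← sub_sub]
  congr 1
  field_simp
  linear_combination g (m - a.1 - q) * h1

/-- If `g m = 0`, the `M` pure modulations of `g` are all orthogonal to the unit vector at `m`. -/
lemma FullSpark.apply_ne_zero {g : Signal M} (hg : FullSpark g) (m : ZMod M) : g m ≠ 0 := by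
  classical
  intro h0
  have h1 := hg (Finset.univ.image fun l : ZMod M => ((0, l) : ZMod M × ZMod M))
    (by rw [Finset.card_image_of_injective _ (Prod.mk_right_injective 0)]; simp [ZMod.card])
    (EuclideanSpace.single m 1) (by
      intro a ha
      obtain ⟨l, -, rfl⟩ := Finset.mem_image.1 ha
      rw [EuclideanSpace.inner_single_right, tfShift_apply]
      simp [h0])
  have h2 := congrArg (fun x : Signal M => x m) h1
  simp at h2

/-- Polarization with two cube roots of unity. -/
lemma mul_conj_eq_of_norm_add_cubeRoot_eq {a b a' b' : ℂ} (ha : ‖a‖ = ‖a'‖) (hb : ‖b‖ = ‖b'‖)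
    (h : ∀ t, ‖a + starRingEnd ℂ (cubeRoot t) * b‖ = ‖a' + starRingEnd ℂ (cubeRoot t) * b'‖) :
    a * starRingEnd ℂ b = a' * starRingEnd ℂ b' := by
  have hnorm : ∀ t, ‖cubeRoot t‖ = 1 := by
    intro t
    have : cubeRoot t = Complex.exp (((2 * Real.pi * (t : ℕ) / 3 : ℝ) : ℂ) * Complex.I) := by
      rw [cubeRoot]; congr 1; push_cast; ring
    rw [this, Complex.norm_exp_ofReal_mul_I]
  -- The moduli of `a` and `b` being known, each `t` yields one real part. The roots for `t = 0, 1`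
  -- are linearly independent over the reals, so they determine the product.
  have key : ∀ t, (cubeRoot t * (a * starRingEnd ℂ b)).re =
      (cubeRoot t * (a' * starRingEnd ℂ b')).re := by
    intro t
    have h1 := congrArg (fun x : ℝ => x ^ 2) (h t)
    simp only [Complex.sq_norm, Complex.normSq_add] at h1
    simp only [← Complex.sq_norm, RCLike.norm_conj, hnorm, ha, hb, map_mul,
      Complex.conj_conj] at h1
    have e1 : a * (cubeRoot t * starRingEnd ℂ b) = cubeRoot t * (a * starRingEnd ℂ b) := by ring
    have e2 : a' * (cubeRoot t * starRingEnd ℂ b') = cubeRoot t * (a' * starRingEnd ℂ b') := by ring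
    rw [e1, e2] at h1
    linarith
  have k0 := key 0
  have k1 := key 1
  have c0 : cubeRoot 0 = 1 := by simp [cubeRoot]
  have c1 : cubeRoot 1 = Complex.exp (((2 * Real.pi / 3 : ℝ) : ℂ) * Complex.I) := by
    rw [cubeRoot]; congr 1; push_cast; simp; ring
  have hs : 0 < (cubeRoot 1).im := by
    rw [c1, Complex.exp_ofReal_mul_I_im]
    exact Real.sin_pos_of_pos_of_lt_pi (by positivity) (by linarith [Real.pi_pos])
  rw [c0, one_mul, one_mul] at k0
  rw [Complex.mul_re (cubeRoot 1), Complex.mul_re (cubeRoot 1), k0] at k1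
  refine Complex.ext k0 ?_
  apply mul_left_cancel₀ hs.ne'
  linarith

/-- If a function on the support of the Gabor coefficients which is constant along the edges has
level sets of at least `M` elements, then the multi-window Gabor system does phase retrieval. -/
lemma isPhaseRetrievable_corollaryFrame {g : Signal M} (hg : FullSpark g) {T P : Finset (ZMod M)}
    (hT : 3 ≤ T.card)
    (hlevel : ∀ S : Finset (ZMod M × ZMod M), S.Nonempty → (∀ a ∈ S, a.1 ∈ T) →
      ∀ u : ZMod M × ZMod M → ℂ, (∀ a ∈ S, ∀ b ∈ S, b.2 - a.2 ∈ P → u a = u b) →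
        ∃ c, S.card ≤ (S.filter fun a => u a = c).card + M) :
    IsPhaseRetrievable (corollaryFrame g T P) := by
  classical
  set Λ : Finset (ZMod M × ZMod M) := T ×ˢ Finset.univ with hΛ
  have hΛcard : Λ.card = T.card * M := by rw [hΛ, Finset.card_product]; simp [ZMod.card]
  have hM : 0 < M := Nat.pos_of_ne_zero (NeZero.ne M)
  have hspark : ∀ S : Finset (ZMod M × ZMod M), M ≤ S.card → ∀ x : Signal M,
      (∀ a ∈ S, inner ℂ (tfShift a g) x = 0) → x = 0 := by
    intro S hS x hx
    obtain ⟨S', hS', hcard⟩ := Finset.exists_subset_card_eq hS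
    exact hg S' hcard x fun a ha => hx a (hS' ha)
  have hMΛ : M ≤ Λ.card := by rw [hΛcard]; nlinarith
  constructor
  · rw [← Submodule.orthogonal_eq_bot_iff, Submodule.eq_bot_iff]
    intro x hx
    refine hspark Λ hMΛ x fun a ha => ?_
    exact Submodule.inner_right_of_mem_orthogonal
      (Submodule.subset_span (Set.mem_range_self (f := corollaryFrame g T P) (none, ⟨a, ha⟩))) hx
  intro x y hxy
  set α : ZMod M × ZMod M → ℂ := fun a => inner ℂ (tfShift a g) x with hα
  set β : ZMod M × ZMod M → ℂ := fun a => inner ℂ (tfShift a g) y with hβ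
  have hnorm : ∀ a ∈ Λ, ‖α a‖ = ‖β a‖ := by
    intro a ha
    have h1 := congrFun hxy (none, ⟨a, ha⟩)
    exact (sq_eq_sq₀ (norm_nonneg _) (norm_nonneg _)).1 h1
  have hedge : ∀ a ∈ Λ, ∀ b ∈ Λ, b.2 - a.2 ∈ P →
      α a * starRingEnd ℂ (α b) = β a * starRingEnd ℂ (β b) := by
    intro a ha b hb hab
    -- The choice `Q = T - T` leaves no constraint on the first coordinates of an edge.
    have hq : b.1 - a.1 ∈ T - T :=
      Finset.sub_mem_sub (Finset.mem_product.1 hb).1 (Finset.mem_product.1 ha).1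
    have hb' : a + (b.1 - a.1, b.2 - a.2) = b := by ext <;> simp
    set w : ℂ := ZMod.stdAddChar (-((b.2 - a.2) * a.1)) with hw
    have hw1 : ‖w‖ = 1 := AddChar.norm_apply _ _
    have h1 : ∀ z t, inner ℂ (tfShift a (auxWindow g (b.1 - a.1) (b.2 - a.2) t)) z =
        inner ℂ (tfShift a g) z + starRingEnd ℂ (cubeRoot t) *
          (starRingEnd ℂ w * inner ℂ (tfShift b g) z) := by
      intro z t
      rw [tfShift_auxWindow hg.apply_ne_zero, hb', inner_add_left, inner_smul_left, map_mul]
      ring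
    have h2 := mul_conj_eq_of_norm_add_cubeRoot_eq (a := α a) (a' := β a)
      (b := starRingEnd ℂ w * α b) (b' := starRingEnd ℂ w * β b) (hnorm a ha)
      (by rw [norm_mul, norm_mul, hnorm b hb]) (by
        intro t
        have h3 := congrFun hxy (some (⟨b.1 - a.1, hq⟩, ⟨b.2 - a.2, hab⟩, t), ⟨a, ha⟩)
        have h4 := (sq_eq_sq₀ (norm_nonneg _) (norm_nonneg _)).1 h3
        rw [hα, hβ]
        simp only
        rw [← h1, ← h1]
        exact h4)
    have hw0 : w ≠ 0 := norm_ne_zero_iff.1 (by rw [hw1]; exact one_ne_zero)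
    apply mul_left_cancel₀ hw0
    simp only [map_mul, Complex.conj_conj] at h2
    linear_combination h2
  by_cases hx : x = 0
  · refine ⟨0, ?_⟩
    rw [hx, smul_zero]
    refine hspark Λ hMΛ y fun a ha => ?_
    have h1 := hnorm a ha
    rw [hα] at h1
    simp only [hx, inner_zero_right, norm_zero] at h1
    exact norm_eq_zero.1 h1.symm
  set S : Finset (ZMod M × ZMod M) := Λ.filter fun a => α a ≠ 0 with hS
  -- By full spark, `M` vanishing coefficients would force `x = 0`.
  have hzero : (Λ.filter fun a => ¬ α a ≠ 0).card < M := by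
    by_contra hc
    push Not at hc
    refine hx (hspark _ hc x fun a ha => ?_)
    exact (Finset.mem_filter.1 ha).2
  have hScard : T.card * M < S.card + M := by
    have : S.card + (Λ.filter fun a => ¬ α a ≠ 0).card = Λ.card :=
      Finset.card_filter_add_card_filter_not _
    rw [hΛcard] at this
    omega
  have h3M : 3 * M ≤ T.card * M := Nat.mul_le_mul_right M hT
  have hSne : S.Nonempty := Finset.card_pos.1 (by omega)
  obtain ⟨c, hc⟩ := hlevel S hSne
    (fun a ha => (Finset.mem_product.1 (Finset.mem_filter.1 ha).1).1) (fun a => β a / α a) (by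
      intro a ha b hb hab
      obtain ⟨haΛ, ha0⟩ := Finset.mem_filter.1 ha
      obtain ⟨hbΛ, hb0⟩ := Finset.mem_filter.1 hb
      have h1 := hedge a haΛ b hbΛ hab
      have h2 : α b * starRingEnd ℂ (α b) = β b * starRingEnd ℂ (β b) := by
        rw [Complex.mul_conj, Complex.mul_conj, Complex.normSq_eq_norm_sq,
          Complex.normSq_eq_norm_sq, hnorm b hbΛ]
      have hβb : β b ≠ 0 := by
        rw [← norm_ne_zero_iff, ← hnorm b hbΛ]; exact norm_ne_zero_iff.2 hb0
      have hβb' : starRingEnd ℂ (β b) ≠ 0 := (map_ne_zero _).2 hβb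
      -- The ratios agree because the products with conjugates agree along the edge and `α b`, `β b`
      -- have equal modulus.
      rw [div_eq_div_iff ha0 hb0]
      apply mul_right_cancel₀ hβb'
      linear_combination (-α b) * h1 + α a * h2)
  -- The support has more than `(|T| - 1) * M ≥ 2 * M` points, and the level set misses at most `M`
  -- of them.
  have hcM : M ≤ (S.filter fun a => β a / α a = c).card := by omega
  have hne : (S.filter fun a => β a / α a = c).Nonempty := Finset.card_pos.1 (by omega)
  have hyx : y = c • x := by
    rw [← sub_eq_zero]
    refine hspark _ hcM _ fun a ha => ?_
    obtain ⟨haS, hac⟩ := Finset.mem_filter.1 ha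
    have ha0 := (Finset.mem_filter.1 haS).2
    rw [inner_sub_right, inner_smul_right]
    have : β a = c * α a := (div_eq_iff ha0).1 hac
    exact sub_eq_zero.2 this
  have hcnorm : ‖c‖ = 1 := by
    obtain ⟨a, ha⟩ := hne
    obtain ⟨haS, hac⟩ := Finset.mem_filter.1 ha
    obtain ⟨haΛ, ha0⟩ := Finset.mem_filter.1 haS
    rw [← hac, norm_div, hnorm a haΛ, div_self]
    rw [← hnorm a haΛ]
    exact norm_ne_zero_iff.2 ha0
  refine ⟨c.arg, ?_⟩
  rw [hyx]
  congr 1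
  have := Complex.norm_mul_exp_arg_mul_I c
  rw [hcnorm, Complex.ofReal_one, one_mul] at this
  exact this.symm

lemma numMeasurements_le (T P : Finset (ZMod M)) :
    numMeasurements T P ≤ (3 * T.card ^ 2 * P.card + 1) * (T.card * M) := by
  have h1 : numMeasurements T P = ((T - T).card * (P.card * 3) + 1) * (T.card * M) := by
    rw [numMeasurements, Fintype.card_prod, Fintype.card_option, Fintype.card_prod,
      Fintype.card_prod, Fintype.card_coe, Fintype.card_coe, Fintype.card_coe, Fintype.card_fin,
      Finset.card_product, Finset.card_univ, ZMod.card]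
  rw [h1]
  refine Nat.mul_le_mul_right _ (Nat.add_le_add_right ?_ 1)
  have h2 : (T - T).card ≤ T.card * T.card := Finset.card_sub_le
  nlinarith [Nat.mul_le_mul_right (P.card * 3) h2]

/-- The deterministic part: small character-sum deviations suffice. -/
lemma isPhaseRetrievable_and_numMeasurements_le {g : Signal M} (hg : FullSpark g)
    {T P : Finset (ZMod M)} (hT : 3 ≤ T.card) {p L : ℝ} (hp : M * p = L) (hL : 1 ≤ L)
    (hP : ∀ j, ‖charSumDeviation P p j‖ ≤ 2 * (1 / (8 * T.card)) * L) :
    IsPhaseRetrievable (corollaryFrame g T P) ∧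
      (numMeasurements T P : ℝ) ≤ (6 * T.card ^ 2 + 1) * T.card * (M * L) := by
  classical
  have hT' : (3 : ℝ) ≤ T.card := by exact_mod_cast hT
  set D : ℝ := 2 * (1 / (8 * T.card)) * L with hDdef
  -- The constant `1 / (8 * |T|)` is chosen so that `2 * D * |T| = L / 2`. The deviation at `j = 0`
  -- puts `|P|` within `L / 12` of `L`, so `|P|` exceeds this and is at most `2 * L`.
  have hD : 4 * D * T.card = L := by rw [hDdef]; field_simp; ring
  have hD0 : 0 ≤ D := by positivity
  have hsum : ∀ j : ZMod M, (∑ m : ZMod M, (ZMod.stdAddChar (j * m) : ℂ)) =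
      if j = 0 then (M : ℂ) else 0 := by
    intro j
    rw [← sum_stdAddChar_mul j]
    exact Finset.sum_congr rfl fun m _ => by rw [mul_comm]
  have h0 := hP 0
  have h0' : charSumDeviation P p 0 = ((P.card - L : ℝ) : ℂ) := by
    rw [charSumDeviation, hsum, if_pos rfl, ← hp]
    simp [mul_comm]
  rw [h0', Complex.norm_real, Real.norm_eq_abs, abs_le] at h0
  have hPj : ∀ j : ZMod M, j ≠ 0 → ‖∑ a ∈ P, (ZMod.stdAddChar (j * a) : ℂ)‖ ≤ D := by
    intro j hj
    have h1 := hP j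
    rwa [charSumDeviation, hsum, if_neg hj, mul_zero, sub_zero] at h1
  have hD12 : D ≤ L / 12 := by nlinarith
  have hPpos : 0 < P.card := by
    have : (0 : ℝ) < P.card := by linarith [h0.1]
    exact_mod_cast this
  constructor
  · exact isPhaseRetrievable_corollaryFrame hg hT fun S hS hST u hu =>
      exists_large_level_set hPj hPpos (by linarith [h0.1]) hD0 hS hST hu
  · have h1 : (numMeasurements T P : ℝ) ≤ (3 * T.card ^ 2 * P.card + 1) * (T.card * M) := by
      exact_mod_cast numMeasurements_le T P
    refine h1.trans ?_
    have h2 : (3 * (T.card : ℝ) ^ 2 * P.card + 1) ≤ (6 * T.card ^ 2 + 1) * L := by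
      have h3 : (P.card : ℝ) ≤ 2 * L := by linarith [h0.2]
      have h4 := mul_le_mul_of_nonneg_left h3 (by positivity : 0 ≤ 3 * (T.card : ℝ) ^ 2)
      linarith
    calc _ ≤ ((6 * (T.card : ℝ) ^ 2 + 1) * L) * (T.card * M) :=
          mul_le_mul_of_nonneg_right h2 (by positivity)
      _ = _ := by ring

end Gabor

end GaborPR

end
-- Choice of constants and the probability estimate
theorem corollary1 (C : ℕ) (hC : 3 < C) :
    ∃ α₀ : ℝ, 0 < α₀ ∧ ∀ α : ℝ, α₀ ≤ α →
      ∃ K : ℝ, ∀ ε : ℝ, 0 < ε → ∃ M₀ : ℕ, ∀ (M : ℕ) [NeZero M], M₀ ≤ M →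
        ∀ T : Finset (ZMod M), T.card = C →
          ∀ (Ω : Type*) [MeasurableSpace Ω] (μ : MeasureTheory.Measure Ω)
            [MeasureTheory.IsProbabilityMeasure μ]
            (g : Ω → Metric.sphere (0 : GaborPR.Signal M) 1) (P : Ω → Finset (ZMod M)),
            ProbabilityTheory.HasLaw g (GaborPR.uniformSphere M) μ →
            GaborPR.IsBernoulliSubset P (α * Real.log M / M) μ →
            μ {ω | ¬ (GaborPR.IsPhaseRetrievable
                        (GaborPR.corollaryFrame (g ω : GaborPR.Signal M) T (P ω)) ∧
                      (GaborPR.numMeasurements T (P ω) : ℝ) ≤ K * (M * Real.log M))} ≤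
              ENNReal.ofReal ε := by
  have hC' : (3 : ℝ) < C := by exact_mod_cast hC
  -- With `δ = 1 / (8 * C)`, the value `512 * C ^ 2 = 8 / δ ^ 2` makes the Chernoff exponent at
  -- least `2 * log M`. The union bound is then at most `4 / M`, whence the threshold `4 / ε`; `M ≥
  -- 3` ensures `log M ≥ 1`.
  refine ⟨512 * (C : ℝ) ^ 2, by positivity, fun α hα =>
    ⟨(6 * (C : ℝ) ^ 2 + 1) * C * α, fun ε hε => ⟨max 3 ⌈4 / ε⌉₊, ?_⟩⟩⟩
  intro M _ hM T hT Ω _ μ _ g P hg hP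
  have hM3 : 3 ≤ M := (le_max_left _ _).trans hM
  have hMpos : (0 : ℝ) < M := by exact_mod_cast (by omega : 0 < M)
  have hMε : 4 / ε ≤ M := (Nat.le_ceil _).trans (by exact_mod_cast (le_max_right _ _).trans hM)
  have hlog : 1 ≤ Real.log M := by
    rw [Real.le_log_iff_exp_le hMpos]
    have h3 : (3 : ℝ) ≤ M := by exact_mod_cast hM3
    linarith [Real.exp_one_lt_d9]
  have hα1 : 1 ≤ α := by nlinarith
  set L : ℝ := α * Real.log M with hL
  have hL1 : 1 ≤ L := by nlinarith
  have hMp : (M : ℝ) * (α * Real.log M / M) = L := by rw [hL]; field_simp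
  set δ : ℝ := 1 / (8 * T.card) with hδ
  have hδ' : δ = 1 / (8 * (C : ℝ)) := by rw [hδ, hT]
  have hbad := GaborPR.measureReal_exists_charSumDeviation_gt_le hP (δ := δ) (by positivity) (by
    rw [hδ', div_le_iff₀ (by positivity)]; linarith)
  rw [hMp] at hbad
  have hexp : (M : ℝ) * (4 * Real.exp (-(δ ^ 2 * L / 4))) ≤ ε := by
    have h1 : 2 * Real.log M ≤ δ ^ 2 * L / 4 := by
      have h2 : δ ^ 2 * α ≥ 8 := by
        rw [hδ', div_pow, one_pow, div_mul_eq_mul_div, one_mul, ge_iff_le,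
          le_div_iff₀ (by positivity)]
        linarith
      have h3 := mul_le_mul_of_nonneg_right h2 (by linarith : 0 ≤ Real.log M)
      rw [hL]
      linarith
    have h2 : Real.exp (-(δ ^ 2 * L / 4)) ≤ 1 / (M : ℝ) ^ 2 := by
      calc _ ≤ Real.exp (-(2 * Real.log M)) := Real.exp_le_exp.2 (by linarith)
        _ = _ := by
          rw [Real.exp_neg, two_mul, Real.exp_add, Real.exp_log hMpos, one_div, sq]
    calc _ ≤ (M : ℝ) * (4 * (1 / (M : ℝ) ^ 2)) := by gcongr
      _ = 4 / M := by field_simp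
      _ ≤ ε := by rwa [div_le_iff₀ hMpos, mul_comm, ← div_le_iff₀ hε]
  have hspark : ∀ᵐ ω ∂μ, GaborPR.FullSpark (g ω : GaborPR.Signal M) :=
    MeasureTheory.ae_of_ae_map hg.aemeasurable
      (hg.map_eq ▸ GaborPR.ae_fullSpark_uniformSphere M)
  set B : Set Ω := {ω | ∃ j, 2 * δ * L < ‖GaborPR.charSumDeviation (P ω) (α * Real.log M / M) j‖}
    with hB
  have hBμ : μ B ≤ ENNReal.ofReal ε := by
    rw [← MeasureTheory.ofReal_measureReal]
    exact ENNReal.ofReal_le_ofReal (hbad.trans hexp)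
  -- Full spark fails only on a null set and `B` involves `P` alone, so the joint law of `g` and `P`
  -- plays no role.
  refine (MeasureTheory.measure_mono_ae ?_).trans hBμ
  filter_upwards [hspark] with ω hω hfail
  by_contra hnot
  apply hfail
  have hsmall : ∀ j, ‖GaborPR.charSumDeviation (P ω) (α * Real.log M / M) j‖ ≤ 2 * δ * L := by
    intro j
    by_contra hj
    exact hnot ⟨j, not_le.1 hj⟩
  have hmain := GaborPR.isPhaseRetrievable_and_numMeasurements_le hω (by omega) hMp hL1 hsmall
  refine ⟨hmain.1, hmain.2.trans_eq ?_⟩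
  rw [hT, hL]
  ring
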